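/- A triple system $\mathcal F$ on a finite vertex set $V$ is a family of $3$-element subsets of $V$; it is linear if any two distinct triples share at most one vertex. For $\mathcal F'\subseteq\mathcal F$ let $V(\mathcal F')$ be the union of its triples. For $A\subseteq V$ let $N(A)$ be the set of all $z\in V\setminus A$ for which there are distinct $x,y\in A$ with $\{x,y,z\}\in\mathcal F$, and let $\mathrm{cl}(A)$ be the smallest $W\supseteq A$ with $N(W)=\emptyset$. $\mathcal F$ is weakly spreading if $\mathrm{cl}(V(\mathcal F'))=V$ for every $\mathcal F'\subseteq\mathcal F$ with $|\mathcal F'|>1$. Let $\xi_{wsp}(n)$ be the minimum number of triples of a linear weakly spreading triple system on $n$ vertices in which every vertex lies in a triple. A Latin square of order $m$ is subsquare-free if it has no subsquare of order $k$ with $1<k<m$. Proposition. Let $n\equiv 3\pmod 6$ and $m=n/3$ (an odd number). (i) Let $L$ be a subsquare-free Latin square of order $m$, with disjoint row set $U=\{u_i\}$, column set $\{v_j\}$ and symbol set $\{w_k\}$, each of size $m$. Let $\mathcal T$ be the system on the $n$ rows, columns and symbols that consists of all triples $\{u_i,v_j,w_k\}$ for which $w_k$ is the symbol in position $(i,j)$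 of $L$. Then $\mathcal T$ is a linear weakly spreading triple system in which every vertex lies in a triple, and it has exactly $n^2/9$ triples. (ii) The minimum $\xi_{wsp}(n)$ exists and $\xi_{wsp}(n)\le n^2/9$. -/

import Mathlib

namespace WeakSpread

section TripleSystems

variable {V : Type*} [DecidableEq V]

/-- `F` is a triple system: a family of 3-element subsets of `V`. -/
def IsTripleSystem (F : Finset (Finset V)) : Prop :=
  ∀ T ∈ F, T.card = 3

/-- `F` is linear: two distinct members have at most one common vertex. -/
def IsLinear (F : Finset (Finset V)) : Prop :=
  ∀ T ∈ F, ∀ T' ∈ F, T ≠ T' → (T ∩ T').card ≤ 1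

/-- The set `V(F)` of the vertices that belong to some triple of `F`. -/
def vertexSet (F : Finset (Finset V)) : Set V :=
  {x | ∃ T ∈ F, x ∈ T}

/-- The shadow (skeleton) of `F`: two distinct vertices are joined if some triple contains both. -/
def shadow (F : Finset (Finset V)) : SimpleGraph V where
  Adj x y := x ≠ y ∧ ∃ T ∈ F, x ∈ T ∧ y ∈ T
  symm := ⟨fun _ _ h => ⟨h.1.symm, h.2.imp fun _ hT => ⟨hT.1, hT.2.2, hT.2.1⟩⟩⟩
  loopless := ⟨fun _ h => h.1 rfl⟩

/-- The neighbours `N(A)`: the vertices `z` outside `A` that form a triple of `F` with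
some edge `xy` of the shadow having both ends in `A`. -/
def neighbours (F : Finset (Finset V)) (A : Set V) : Set V :=
  {z | z ∉ A ∧ ∃ x ∈ A, ∃ y ∈ A, (shadow F).Adj x y ∧ ({x, y, z} : Finset V) ∈ F}

/-- The closure `cl(A)`: the smallest superset of `A` without neighbours
(see `isLeast_closure`). -/
def closure (F : Finset (Finset V)) (A : Set V) : Set V :=
  ⋂₀ {W | A ⊆ W ∧ neighbours F W = ∅}

theorem isLeast_closure (F : Finset (Finset V)) (A : Set V) :
    IsLeast {W | A ⊆ W ∧ neighbours F W = ∅} (closure F A) := by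
  refine ⟨⟨fun x hx W hW => hW.1 hx, ?_⟩, fun W hW => Set.sInter_subset_of_mem hW⟩
  rw [Set.eq_empty_iff_forall_notMem]
  rintro z ⟨hz, x, hx, y, hy, hadj, hT⟩
  apply hz
  intro W hW
  by_contra hzW
  have : z ∈ neighbours F W := ⟨hzW, x, hx W hW, y, hy W hW, hadj, hT⟩
  rw [hW.2] at this
  exact this

/-- `F` is weakly spreading: the vertex set of any subfamily of more than one triple has
closure `V`. -/
def IsWeaklySpreading (F : Finset (Finset V)) : Prop :=
  ∀ F' ⊆ F, 1 < F'.card → closure F (vertexSet F') = Set.univ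

end TripleSystems

/-- The minimum number of triples of a linear weakly spreading triple system on `n` vertices.
Every vertex has to lie in a triple: otherwise a family of at most one triple would qualify
vacuously for every `n`. (A weakly spreading system of at least two triples always has this
property.) The value is `⊤` if there is no such system. -/
noncomputable def xiWsp (n : ℕ) : ℕ∞ :=
  sInf {k | ∃ F : Finset (Finset (Fin n)), IsTripleSystem F ∧ IsLinear F ∧
    vertexSet F = Set.univ ∧ IsWeaklySpreading F ∧ k = (F.card : ℕ∞)}

section LatinSquares

variable {m : ℕ}

/-- A Latin square of order `m`: every symbol appears exactly once in every row and
in every column. -/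
def IsLatinSquare (L : Matrix (Fin m) (Fin m) (Fin m)) : Prop :=
  (∀ i k, ∃! j, L i j = k) ∧ (∀ j k, ∃! i, L i j = k)

/-- The submatrix of `L` with row set `R` and column set `C` is itself a Latin square,
on some symbol set `S`. -/
def IsSubsquare (L : Matrix (Fin m) (Fin m) (Fin m)) (R C : Finset (Fin m)) : Prop :=
  ∃ S : Finset (Fin m), R.card = S.card ∧ C.card = S.card ∧
    (∀ i ∈ R, ∀ j ∈ C, L i j ∈ S) ∧
    (∀ i ∈ R, ∀ k ∈ S, ∃! j, j ∈ C ∧ L i j = k) ∧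
    (∀ j ∈ C, ∀ k ∈ S, ∃! i, i ∈ R ∧ L i j = k)

/-- `L` has no subsquare of order strictly between `1` and `m`. -/
def IsSubsquareFree (L : Matrix (Fin m) (Fin m) (Fin m)) : Prop :=
  ¬ ∃ R C : Finset (Fin m), IsSubsquare L R C ∧ 1 < R.card ∧ R.card < m

/-- The vertex set of the construction: the disjoint union of the rows, the columns and
the symbols. -/
abbrev LatinVertex (m : ℕ) : Type := Fin m ⊕ (Fin m ⊕ Fin m)

/-- The triples `{u_i, v_j, w_k}` where `w_k` is the symbol in position `(i, j)`. -/
def latinTriples (L : Matrix (Fin m) (Fin m) (Fin m)) : Finset (Finset (LatinVertex m)) :=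
  Finset.univ.image fun p : Fin m × Fin m =>
    {Sum.inl p.1, Sum.inr (Sum.inl p.2), Sum.inr (Sum.inr (L p.1 p.2))}

end LatinSquares

end WeakSpread

/-! Both parts rest on `PairsSpread`: a set that absorbs every triple meeting it twice, and that
contains two distinct triples, is everything.

For a Latin square, let R, C, S be the rows, columns and symbols in such a set. Any two coordinates
of a cell determine the third, so R, C and S have equal size and span a subsquare. Two distinct
triples force its order above 1, so subsquare-freeness makes it the whole square
(`IsLatinSquare.pairsSpread_latinTriples`).

The bound on the minimum is proved without subsquare-free squares. For n > 3, Bertrand's postulate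
gives an odd prime p with 2p ≤ n ≤ 4p, and systems are built from the triples {a, b, a + b} over
`ZMod p`, the sum lying in a second layer. From points a, c, v one obtains the sum a + v and then
the point v + (a - c); since a - c generates `ZMod p`, three points yield all points and all sums
(`IsClosedFor.forall_mem_of_pairTriples`). If n = 2p + t ≤ 3p, two layers and t extra vertices
suffice; when t is small, the triples on pairs inside a set R are dropped to save about p²/18 of
them. If n = 3p + t > 3p, three layers are linked by two sum systems and by the triples {a, 2a, 4a},
giving at most p² + t triples. The case n = 3 is a single triple. -/

namespace WeakSpread

/-! ### Closed sets and transport to `Fin n` -/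

section Criteria

variable {V : Type*} [DecidableEq V]

/-- `W` contains every triple of `F` of which it contains two vertices. -/
def IsClosedFor (F : Finset (Finset V)) (W : Set V) : Prop :=
  ∀ T ∈ F, ∀ x ∈ T, ∀ y ∈ T, x ≠ y → x ∈ W → y ∈ W → ∀ z ∈ T, z ∈ W

/-- Any closed set containing two distinct triples is everything. -/
def PairsSpread (F : Finset (Finset V)) : Prop :=
  ∀ W, IsClosedFor F W → ∀ T ∈ F, ∀ T' ∈ F, T ≠ T' → (∀ x ∈ T, x ∈ W) → (∀ x ∈ T', x ∈ W) →
    W = Set.univ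

theorem isClosedFor_of_neighbours_eq_empty {F : Finset (Finset V)} (hF : IsTripleSystem F)
    {W : Set V} (hW : neighbours F W = ∅) : IsClosedFor F W := by
  intro T hT x hx y hy hxy hxW hyW z hz
  by_contra hzW
  have hxz : x ≠ z := by rintro rfl; exact hzW hxW
  have hyz : y ≠ z := by rintro rfl; exact hzW hyW
  have hsub : ({x, y, z} : Finset V) = T := by
    apply Finset.eq_of_subset_of_card_le
    · intro w hw
      simp only [Finset.mem_insert, Finset.mem_singleton] at hw
      rcases hw with rfl | rfl | rfl <;> assumption
    · rw [hF T hT, Finset.card_eq_three.2 ⟨x, y, z, hxy, hxz, hyz, rfl⟩]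
  have : z ∈ neighbours F W := ⟨hzW, x, hxW, y, hyW, ⟨hxy, T, hT, hx, hy⟩, hsub ▸ hT⟩
  rw [hW] at this
  exact this

theorem PairsSpread.isWeaklySpreading {F : Finset (Finset V)} (hF : IsTripleSystem F)
    (h : PairsSpread F) : IsWeaklySpreading F := by
  intro F' hF' hcard
  obtain ⟨T, hT, T', hT', hne⟩ := Finset.one_lt_card.1 hcard
  obtain ⟨⟨hsub, hcl⟩, -⟩ := isLeast_closure F (vertexSet F')
  exact h _ (isClosedFor_of_neighbours_eq_empty hF hcl) T (hF' hT) T' (hF' hT') hne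
    (fun x hx => hsub ⟨T, hT, hx⟩) (fun x hx => hsub ⟨T', hT', hx⟩)

/-- The vertex set is itself closed and contains every triple. -/
theorem PairsSpread.vertexSet_eq_univ {F : Finset (Finset V)} (h : PairsSpread F)
    (hcard : 1 < F.card) : vertexSet F = Set.univ := by
  obtain ⟨T, hT, T', hT', hne⟩ := Finset.one_lt_card.1 hcard
  exact h _ (fun T hT _ _ _ _ _ _ _ z hz => ⟨T, hT, hz⟩) T hT T' hT' hne (fun x hx => ⟨T, hT, hx⟩) (fun x hx => ⟨T', hT', hx⟩)

theorem isLinear_of_unique {F : Finset (Finset V)}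
    (h : ∀ T ∈ F, ∀ T' ∈ F, ∀ x y, x ≠ y → x ∈ T → y ∈ T → x ∈ T' → y ∈ T' → T = T') :
    IsLinear F := by
  intro T hT T' hT' hne
  rw [Finset.card_le_one]
  intro x hx y hy
  by_contra hxy
  rw [Finset.mem_inter] at hx hy
  exact hne (h T hT T' hT' x y hxy hx.1 hy.1 hx.2 hy.2)

theorem xiWsp_le_of_card_eq [Fintype V] {n : ℕ} (hV : Fintype.card V = n)
    {F : Finset (Finset V)} (h3 : IsTripleSystem F) (hl : IsLinear F) (hs : PairsSpread F)
    (hcard : 1 < F.card) : xiWsp n ≤ F.card := by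
  let e : V ≃ Fin n := Fintype.equivFinOfCardEq hV
  let φ : Finset V ↪ Finset (Fin n) := (Finset.mapEmbedding e.toEmbedding).toEmbedding
  have hφ : ∀ T, φ T = T.map e.toEmbedding := fun _ => rfl
  have h3' : IsTripleSystem (F.map φ) := by
    intro T hT
    obtain ⟨S, hS, rfl⟩ := Finset.mem_map.1 hT
    rw [hφ, Finset.card_map, h3 S hS]
  have hs' : PairsSpread (F.map φ) := by
    intro W hW T hT T' hT' hne hTW hTW'
    obtain ⟨S, hS, rfl⟩ := Finset.mem_map.1 hT
    obtain ⟨S', hS', rfl⟩ := Finset.mem_map.1 hT'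
    have hmem : ∀ (S : Finset V) (x : V), x ∈ S → e x ∈ φ S := fun S x hx => by
      rw [hφ]; exact Finset.mem_map_of_mem e.toEmbedding hx
    have := hs (e ⁻¹' W) ?_ S hS S' hS' (fun h => hne (h ▸ rfl))
      (fun x hx => hTW _ (hmem S x hx)) (fun x hx => hTW' _ (hmem S' x hx))
    · ext y
      have hy : e.symm y ∈ e ⁻¹' W := this ▸ Set.mem_univ _
      simpa using hy
    · intro T hT x hx y hy hxy hxW hyW z hz
      exact hW (φ T) (Finset.mem_map_of_mem φ hT) (e x) (hmem T x hx) (e y) (hmem T y hy)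
        (e.injective.ne hxy) hxW hyW (e z) (hmem T z hz)
  refine sInf_le ⟨F.map φ, h3', ?_, hs'.vertexSet_eq_univ (by rwa [Finset.card_map]),
    hs'.isWeaklySpreading h3', by rw [Finset.card_map]⟩
  intro T hT T' hT' hne
  obtain ⟨S, hS, rfl⟩ := Finset.mem_map.1 hT
  obtain ⟨S', hS', rfl⟩ := Finset.mem_map.1 hT'
  rw [hφ, hφ, ← Finset.map_inter, Finset.card_map]
  exact hl S hS S' hS' (fun h => hne (h ▸ rfl))

end Criteria

/-! ### Subsquare-free Latin squares -/

section LatinSquares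

variable {m : ℕ} {L : Matrix (Fin m) (Fin m) (Fin m)}

theorem mem_latinTriples {T : Finset (LatinVertex m)} : T ∈ latinTriples L ↔
    ∃ i j, T = {Sum.inl i, Sum.inr (Sum.inl j), Sum.inr (Sum.inr (L i j))} := by
  simp [latinTriples, eq_comm]

theorem isTripleSystem_latinTriples : IsTripleSystem (latinTriples L) := by
  intro T hT
  obtain ⟨i, j, rfl⟩ := mem_latinTriples.1 hT
  exact Finset.card_eq_three.2 ⟨_, _, _, by simp, by simp, by simp, rfl⟩

theorem IsLatinSquare.isLinear_latinTriples (hL : IsLatinSquare L) :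
    IsLinear (latinTriples L) := by
  apply isLinear_of_unique
  intro T hT T' hT' x y hxy hx hy hx' hy'
  obtain ⟨i, j, rfl⟩ := mem_latinTriples.1 hT
  obtain ⟨i', j', rfl⟩ := mem_latinTriples.1 hT'
  have h1 : i = i' → L i j = L i' j' → j = j' := fun h h' =>
    (hL.1 i (L i j)).unique rfl (by rw [h', h])
  have h2 : j = j' → L i j = L i' j' → i = i' := fun h h' =>
    (hL.2 j (L i j)).unique rfl (by rw [h', h])
  simp only [Finset.mem_insert, Finset.mem_singleton] at hx hy hx' hy'
  suffices i = i' ∧ j = j' by rw [this.1, this.2]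
  rcases hx with rfl | rfl | rfl <;> rcases hy with rfl | rfl | rfl <;> simp_all

theorem card_latinTriples : (latinTriples L).card = m * m := by
  rw [latinTriples, Finset.card_image_of_injective]
  · simp
  · rintro ⟨i, j⟩ ⟨i', j'⟩ h
    have hi := (Finset.ext_iff.1 h (Sum.inl i)).1 (by simp)
    have hj := (Finset.ext_iff.1 h (Sum.inr (Sum.inl j))).1 (by simp)
    simp at hi hj
    rw [hi, hj]

theorem IsLatinSquare.vertexSet_latinTriples (hL : IsLatinSquare L) :
    vertexSet (latinTriples L) = Set.univ := by
  rw [Set.eq_univ_iff_forall]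
  rintro (i | j | k)
  · exact ⟨_, mem_latinTriples.2 ⟨i, i, rfl⟩, by simp⟩
  · exact ⟨_, mem_latinTriples.2 ⟨j, j, rfl⟩, by simp⟩
  · obtain ⟨j, hj, -⟩ := hL.1 k k
    exact ⟨_, mem_latinTriples.2 ⟨k, j, rfl⟩, by simp [hj]⟩

/-- A closed set containing a triple cuts out a subsquare: one row of the set matches its columns
with its symbols, and one column matches its rows with its symbols. -/
theorem IsLatinSquare.pairsSpread_latinTriples (hL : IsLatinSquare L)
    (hfree : IsSubsquareFree L) : PairsSpread (latinTriples L) := by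
  classical
  intro W hW T hT T' hT' hne hTW hTW'
  obtain ⟨i, j, rfl⟩ := mem_latinTriples.1 hT
  obtain ⟨i', j', rfl⟩ := mem_latinTriples.1 hT'
  simp only [Finset.mem_insert, Finset.mem_singleton, forall_eq_or_imp, forall_eq] at hTW hTW'
  let R : Finset (Fin m) := Finset.univ.filter fun i => (Sum.inl i : LatinVertex m) ∈ W
  let C : Finset (Fin m) := Finset.univ.filter fun j => (Sum.inr (Sum.inl j) : LatinVertex m) ∈ W
  let S : Finset (Fin m) := Finset.univ.filter fun k => (Sum.inr (Sum.inr k) : LatinVertex m) ∈ W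
  have memR : ∀ i, i ∈ R ↔ (Sum.inl i : LatinVertex m) ∈ W := by simp [R]
  have memC : ∀ j, j ∈ C ↔ (Sum.inr (Sum.inl j) : LatinVertex m) ∈ W := by simp [C]
  have memS : ∀ k, k ∈ S ↔ (Sum.inr (Sum.inr k) : LatinVertex m) ∈ W := by simp [S]
  simp only [← memR, ← memC, ← memS] at hTW hTW'
  have hRC : ∀ i j, i ∈ R → j ∈ C → L i j ∈ S := fun i j hi hj => (memS _).2 <|
    hW _ (mem_latinTriples.2 ⟨i, j, rfl⟩) (Sum.inl i) (by simp) (Sum.inr (Sum.inl j)) (by simp)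
      (by simp) ((memR _).1 hi) ((memC _).1 hj) _ (by simp)
  have hRS : ∀ i j, i ∈ R → L i j ∈ S → j ∈ C := fun i j hi hj => (memC _).2 <|
    hW _ (mem_latinTriples.2 ⟨i, j, rfl⟩) (Sum.inl i) (by simp) (Sum.inr (Sum.inr (L i j)))
      (by simp) (by simp) ((memR _).1 hi) ((memS _).1 hj) _ (by simp)
  have hCS : ∀ i j, j ∈ C → L i j ∈ S → i ∈ R := fun i j hi hj => (memR _).2 <|
    hW _ (mem_latinTriples.2 ⟨i, j, rfl⟩) (Sum.inr (Sum.inl j)) (by simp)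
      (Sum.inr (Sum.inr (L i j))) (by simp) (by simp) ((memC _).1 hi) ((memS _).1 hj) _ (by simp)
  have hCcard : C.card = S.card := by
    refine Finset.card_bij (fun j _ => L i j) (fun j hj => hRC i j hTW.1 hj) ?_ ?_
    · intro j₁ _ j₂ _ h
      exact (hL.1 i (L i j₂)).unique h rfl
    · intro k hk
      obtain ⟨j, rfl, -⟩ := hL.1 i k
      exact ⟨j, hRS i j hTW.1 hk, rfl⟩
  have hRcard : R.card = S.card := by
    refine Finset.card_bij (fun i _ => L i j) (fun i hi => hRC i j hi hTW.2.1) ?_ ?_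
    · intro i₁ _ i₂ _ h
      exact (hL.2 j (L i₂ j)).unique h rfl
    · intro k hk
      obtain ⟨i, rfl, -⟩ := hL.2 j k
      exact ⟨i, hCS i j hTW.2.1 hk, rfl⟩
  have hsq : IsSubsquare L R C := by
    refine ⟨S, hRcard, hCcard, fun i hi j hj => hRC i j hi hj, ?_, ?_⟩
    · intro i hi k hk
      obtain ⟨j, rfl, hu⟩ := hL.1 i k
      exact ⟨j, ⟨hRS i j hi hk, rfl⟩, fun j' h => hu j' h.2⟩
    · intro j hj k hk
      obtain ⟨i, rfl, hu⟩ := hL.2 j k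
      exact ⟨i, ⟨hCS i j hj hk, rfl⟩, fun i' h => hu i' h.2⟩
  have hone : 1 < R.card := by
    -- Distinct triples differ in the row or in the column, and either suffices because R and C have
    -- equal size.
    by_cases hii : i = i'
    · subst hii
      have hjj : j ≠ j' := by rintro rfl; exact hne rfl
      rw [hRcard, ← hCcard]
      exact Finset.one_lt_card.2 ⟨j, hTW.2.1, j', hTW'.2.1, hjj⟩
    · exact Finset.one_lt_card.2 ⟨i, hTW.1, i', hTW'.1, hii⟩
  have hm : m ≤ R.card := by
    by_contra h
    exact hfree ⟨R, C, hsq, hone, not_le.1 h⟩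
  have full : ∀ X : Finset (Fin m), X.card = R.card → ∀ x, x ∈ X := fun X hX x => by
    have : X = Finset.univ := Finset.eq_univ_of_card X (le_antisymm (Finset.card_le_univ X)
      (by rw [hX]; simpa using hm))
    rw [this]; exact Finset.mem_univ x
  rw [Set.eq_univ_iff_forall]
  rintro (i | j | k)
  · exact (memR i).1 (full R rfl i)
  · exact (memC j).1 (full C (hCcard.trans hRcard.symm) j)
  · exact (memS k).1 (full S hRcard.symm k)

end LatinSquares

/-! ### Almost translation-invariant subsets of `ZMod p` -/

section Translation

variable {p : ℕ} [Fact p.Prime]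

/-- A subset of `ZMod p` that is invariant under translation by `a - c`, except that the
forward translation may fail at `a` and the backward one at `c`, is everything as soon as it
contains a third element. -/
theorem forall_mem_of_translation {A : Set (ZMod p)} {a c u : ZMod p} (hac : a ≠ c)
    (hua : u ≠ a) (huc : u ≠ c) (hu : u ∈ A)
    (hfwd : ∀ v ∈ A, v ≠ a → v + (a - c) ∈ A) (hbwd : ∀ v ∈ A, v ≠ c → v - (a - c) ∈ A)
    (v : ZMod p) : v ∈ A := by
  have hδ : a - c ≠ 0 := sub_ne_zero.2 hac
  have coord : ∀ b w : ZMod p, w = b + (((w - b) / (a - c)).val : ZMod p) * (a - c) := by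
    intro b w
    rw [ZMod.natCast_zmod_val]
    field_simp
    ring
  -- In steps of a - c the residues run a, a + (a - c), ..., ending at c. Walking back from u
  -- reaches a + (a - c) without leaving from c, which repairs the one missing forward step, the one
  -- at a.
  have back : ∀ j : ℕ, j + 2 < p → a + ((j + 1 : ℕ) : ZMod p) * (a - c) ∈ A →
      a + (a - c) ∈ A := by
    intro j
    induction j with
    | zero => intro _ h; simpa using h
    | succ j ih =>
      intro hj h
      apply ih (by omega)
      have hne : a + ((j + 1 + 1 : ℕ) : ZMod p) * (a - c) ≠ c := by
        intro h0
        have h1 : ((j + 3 : ℕ) : ZMod p) * (a - c) = 0 := by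
          push_cast at h0 ⊢
          linear_combination h0
        rcases mul_eq_zero.1 h1 with h2 | h2
        · rw [ZMod.natCast_eq_zero_iff] at h2
          exact absurd (Nat.le_of_dvd (by omega) h2) (by omega)
        · exact hδ h2
      have := hbwd _ h hne
      convert this using 1
      push_cast
      ring
  have ha : a + (a - c) ∈ A := by
    set k := ((u - a) / (a - c)).val with hk
    have hku := coord a u
    rw [← hk] at hku
    have hkp : k < p := ZMod.val_lt _
    have hk0 : k ≠ 0 := by
      intro h
      rw [h] at hku
      exact hua (by simpa using hku)
    have hk1 : k + 1 ≠ p := by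
      intro h
      apply huc
      have hk' : (k : ZMod p) = -1 := by
        have : ((k + 1 : ℕ) : ZMod p) = 0 := by rw [h]; exact ZMod.natCast_self p
        push_cast at this
        linear_combination this
      rw [hku, hk']
      ring
    apply back (k - 1) (by omega)
    rwa [Nat.sub_add_cancel (by omega), ← hku]
  have step : ∀ w ∈ A, w + (a - c) ∈ A := by
    intro w hw
    by_cases h : w = a
    · rwa [h]
    · exact hfwd w hw h
  have all : ∀ j : ℕ, u + (j : ZMod p) * (a - c) ∈ A := by
    intro j
    induction j with
    | zero => simpa using hu
    | succ j ih =>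
      have := step _ ih
      convert this using 1
      push_cast
      ring
  rw [coord u v]
  exact all _

/-- `2` is invertible modulo an odd prime. -/
theorem two_ne_zero_of_two_lt (hp : 2 < p) : (2 : ZMod p) ≠ 0 := by
  intro h
  have h2 : ((2 : ℕ) : ZMod p) = 0 := by exact_mod_cast h
  rw [ZMod.natCast_eq_zero_iff] at h2
  exact absurd (Nat.le_of_dvd (by omega) h2) (by omega)

end Translation

/-! ### Sum triples over `ZMod p` -/

section PairTriples

variable {V : Type*} [DecidableEq V] {p : ℕ} [Fact p.Prime]

/-- The triples `{i a, i b, j (a + b)}` for `a ≠ b` not both in `R`. -/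
def pairTriples (i j : ZMod p → V) (R : Finset (ZMod p)) : Finset (Finset V) :=
  (Finset.univ.powersetCard 2 \ R.powersetCard 2).image
    fun s => insert (j (∑ a ∈ s, a)) (s.image i)

theorem mem_pairTriples {i j : ZMod p → V} {R : Finset (ZMod p)} {T : Finset V} :
    T ∈ pairTriples i j R ↔
      ∃ a b, a ≠ b ∧ ¬ (a ∈ R ∧ b ∈ R) ∧ T = {i a, i b, j (a + b)} := by
  have key : ∀ a b, a ≠ b →
      insert (j (∑ x ∈ ({a, b} : Finset (ZMod p)), x)) (({a, b} : Finset (ZMod p)).image i) =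
        {i a, i b, j (a + b)} := by
    intro a b hab
    rw [Finset.sum_pair hab, Finset.image_insert, Finset.image_singleton]
    ext x
    simp only [Finset.mem_insert, Finset.mem_singleton]
    tauto
  simp only [pairTriples, Finset.mem_image, Finset.mem_sdiff, Finset.mem_powersetCard]
  constructor
  · rintro ⟨s, ⟨⟨-, hs⟩, hR⟩, rfl⟩
    obtain ⟨a, b, hab, rfl⟩ := Finset.card_eq_two.1 hs
    exact ⟨a, b, hab, fun h => hR ⟨by simp [Finset.insert_subset_iff, h], hs⟩, key a b hab⟩
  · rintro ⟨a, b, hab, hR, rfl⟩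
    refine ⟨{a, b}, ⟨⟨Finset.subset_univ _, Finset.card_pair hab⟩, fun h => hR ?_⟩, key a b hab⟩
    simpa [Finset.insert_subset_iff] using h.1

theorem card_pairTriples_le (i j : ZMod p → V) (R : Finset (ZMod p)) :
    (pairTriples i j R).card + R.card.choose 2 ≤ p.choose 2 := by
  have h1 : (pairTriples i j R).card ≤ _ := Finset.card_image_le
  have h2 := Finset.card_sdiff_add_card_eq_card
    (Finset.powersetCard_mono (n := 2) (Finset.subset_univ R))
  rw [Finset.card_powersetCard, Finset.card_powersetCard, Finset.card_univ, ZMod.card] at h2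
  omega

end PairTriples

section PairTriples

variable {V : Type*} [DecidableEq V] {p : ℕ} [Fact p.Prime] {i j : ZMod p → V}
  {R : Finset (ZMod p)} {F : Finset (Finset V)} {W : Set V}

theorem IsClosedFor.add_mem (hW : IsClosedFor F W) (hi : i.Injective)
    (hF : pairTriples i j R ⊆ F) {a b : ZMod p} (hab : a ≠ b) (hR : ¬ (a ∈ R ∧ b ∈ R))
    (ha : i a ∈ W) (hb : i b ∈ W) : j (a + b) ∈ W :=
  hW _ (hF (mem_pairTriples.2 ⟨a, b, hab, hR, rfl⟩)) (i a) (by simp) (i b) (by simp)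
    (hi.ne hab) ha hb _ (by simp)

theorem IsClosedFor.of_add_mem (hW : IsClosedFor F W) (hij : ∀ a x, i a ≠ j x)
    (hF : pairTriples i j R ⊆ F) {a b : ZMod p} (hab : a ≠ b) (hR : ¬ (a ∈ R ∧ b ∈ R))
    (ha : i a ∈ W) (hx : j (a + b) ∈ W) : i b ∈ W :=
  hW _ (hF (mem_pairTriples.2 ⟨a, b, hab, hR, rfl⟩)) (i a) (by simp) (j (a + b)) (by simp)
    (hij _ _) ha hx _ (by simp)

/-- The sum a + v, completed with c, gives v + (a - c); exchanging a and c gives the inverse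
translation. Since a and c avoid R, every pair used is allowed unless it degenerates, and those
degenerate cases are the exceptions in `forall_mem_of_translation`. -/
theorem IsClosedFor.forall_mem_of_pairTriples (hW : IsClosedFor F W) (hp : 2 < p)
    (hi : i.Injective) (hij : ∀ a x, i a ≠ j x) (hF : pairTriples i j R ⊆ F) {a c u : ZMod p}
    (haR : a ∉ R) (hcR : c ∉ R) (hac : a ≠ c) (hua : u ≠ a) (huc : u ≠ c) (ha : i a ∈ W)
    (hc : i c ∈ W) (hu : i u ∈ W) : (∀ v, i v ∈ W) ∧ ∀ x, j x ∈ W := by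
  have shift : ∀ a c : ZMod p, a ∉ R → c ∉ R → a ≠ c → i a ∈ W → i c ∈ W → ∀ v, i v ∈ W →
      v ≠ a → i (v + (a - c)) ∈ W := by
    intro a c haR hcR hac ha hc v hv hva
    have h1 : j (a + v) ∈ W := hW.add_mem hi hF hva.symm (fun h => haR h.1) ha hv
    by_cases hcv : c = v + (a - c)
    · rwa [← hcv]
    · refine hW.of_add_mem hij hF hcv (fun h => hcR h.1) hc ?_
      convert h1 using 2
      ring
  have hall : ∀ v, i v ∈ W := forall_mem_of_translation (A := i ⁻¹' W) hac hua huc hu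
    (shift a c haR hcR hac ha hc)
    (fun v hv hvc => by
      have := shift c a hcR haR hac.symm hc ha v hv hvc
      rwa [show v + (c - a) = v - (a - c) by ring] at this)
  refine ⟨hall, fun x => ?_⟩
  -- The sum x is reached from a unless x = 2a; as 2 is invertible, a or c works.
  have aux : ∀ a, a ∉ R → a ≠ x - a → j x ∈ W := by
    intro a haR hne
    have := hW.add_mem hi hF hne (fun h => haR h.1) (hall a) (hall (x - a))
    rwa [add_sub_cancel] at this
  by_cases h : a = x - a
  · refine aux c hcR fun h' => hac (mul_left_cancel₀ (two_ne_zero_of_two_lt hp) ?_)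
    linear_combination h - h'
  · exact aux a haR h

end PairTriples

/-! ### The two-layer system, for 2p ≤ n ≤ 3p -/

section TwoLayers

variable {p : ℕ} [Fact p.Prime]

/-- Points and sums indexed by `ZMod p`, together with an extra vertex for each element of `T`. -/
abbrev TwoLayerVertex (p : ℕ) (T : Finset (ZMod p)) : Type :=
  ZMod p ⊕ (ZMod p ⊕ {a // a ∈ T})

/-- The triples `{a, b, a + b}` for `a ≠ b` not both in `R`, and `{a, 2a, extra a}` for `a ∈ T`. -/
def twoLayerTriples (R T : Finset (ZMod p)) : Finset (Finset (TwoLayerVertex p T)) :=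
  pairTriples Sum.inl (fun x => Sum.inr (Sum.inl x)) R ∪
    Finset.univ.image fun e : {a // a ∈ T} =>
      {Sum.inl e.1, Sum.inr (Sum.inl (2 * e.1)), Sum.inr (Sum.inr e)}

variable {R T : Finset (ZMod p)}

theorem mem_twoLayerTriples {X : Finset (TwoLayerVertex p T)} : X ∈ twoLayerTriples R T ↔
    (∃ a b, a ≠ b ∧ ¬ (a ∈ R ∧ b ∈ R) ∧ X = {Sum.inl a, Sum.inl b, Sum.inr (Sum.inl (a + b))}) ∨
    ∃ e : {a // a ∈ T}, X = {Sum.inl e.1, Sum.inr (Sum.inl (2 * e.1)), Sum.inr (Sum.inr e)} := by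
  rw [twoLayerTriples, Finset.mem_union, mem_pairTriples]
  simp only [Finset.mem_image, Finset.mem_univ, true_and, eq_comm (a := X)]

theorem isTripleSystem_twoLayerTriples : IsTripleSystem (twoLayerTriples R T) := by
  intro X hX
  rcases mem_twoLayerTriples.1 hX with ⟨a, b, hab, -, rfl⟩ | ⟨e, rfl⟩
  · exact Finset.card_eq_three.2 ⟨_, _, _, by simpa using hab, by simp, by simp, rfl⟩
  · exact Finset.card_eq_three.2 ⟨_, _, _, by simp, by simp, by simp, rfl⟩

/-- The point a and the sum 2a lie in no sum triple, because a + a is excluded; the extra triples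
use exactly such pairs. -/
theorem isLinear_twoLayerTriples (hp : 2 < p) : IsLinear (twoLayerTriples R T) := by
  have h2 : ∀ a b : ZMod p, 2 * a = 2 * b → a = b := fun a b h =>
    mul_left_cancel₀ (two_ne_zero_of_two_lt hp) h
  have hswap : ∀ a b : ZMod p, ({Sum.inl a, Sum.inl b, Sum.inr (Sum.inl (a + b))} :
      Finset (TwoLayerVertex p T)) = {Sum.inl b, Sum.inl a, Sum.inr (Sum.inl (b + a))} := by
    intro a b
    rw [Finset.insert_comm, add_comm]
  apply isLinear_of_unique
  intro X hX Y hY x y hxy hx hy hx' hy'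
  rcases mem_twoLayerTriples.1 hX with ⟨a, b, hab, -, rfl⟩ | ⟨e, rfl⟩ <;>
  rcases mem_twoLayerTriples.1 hY with ⟨a', b', hab', -, rfl⟩ | ⟨e', rfl⟩ <;>
  simp only [Finset.mem_insert, Finset.mem_singleton] at hx hy hx' hy'
  · suffices h : (a = a' ∧ b = b') ∨ (a = b' ∧ b = a') by
      rcases h with ⟨rfl, rfl⟩ | ⟨rfl, rfl⟩
      · rfl
      · exact hswap _ _
    rcases x with x | x | x <;> rcases y with y | y | y <;> simp at hx hy hx' hy' hxy <;> grind
  · exfalso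
    rcases x with x | x | x <;> rcases y with y | y | y <;> simp at hx hy hx' hy' hxy <;> grind
  · exfalso
    rcases x with x | x | x <;> rcases y with y | y | y <;> simp at hx hy hx' hy' hxy <;> grind
  · suffices h : e = e' by rw [h]
    rcases x with x | x | x <;> rcases y with y | y | y <;> simp at hx hy hx' hy' hxy <;> grind

theorem card_twoLayerTriples_le :
    (twoLayerTriples R T).card + R.card.choose 2 ≤ p.choose 2 + T.card := by
  have h1 := card_pairTriples_le (V := TwoLayerVertex p T) Sum.inl (fun x => Sum.inr (Sum.inl x)) R
  have h2 := Finset.card_union_le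
    (pairTriples (V := TwoLayerVertex p T) Sum.inl (fun x => Sum.inr (Sum.inl x)) R)
    (Finset.univ.image fun e : {a // a ∈ T} =>
      {Sum.inl e.1, Sum.inr (Sum.inl (2 * e.1)), Sum.inr (Sum.inr e)})
  have h3 := Finset.card_image_le (s := Finset.univ) (f := fun e : {a // a ∈ T} =>
      ({Sum.inl e.1, Sum.inr (Sum.inl (2 * e.1)), Sum.inr (Sum.inr e)} :
        Finset (TwoLayerVertex p T)))
  rw [Finset.card_univ, Fintype.card_coe] at h3
  rw [twoLayerTriples]
  omega

/-- The hypothesis `hR` says that a point outside `R` is not the midpoint of a translated pair of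
`R`, and `hT` that an element of `T` is not the midpoint of a pair of `R`. -/
theorem pairsSpread_twoLayerTriples (hp : 2 < p) (hTR : Disjoint T R)
    (hR : ∀ a ∉ R, ∀ b ∈ R, ∀ b' ∈ R, b ≠ b' → a + b' - b ∈ R → a + b - b' ∉ R)
    (hT : ∀ a ∈ T, ∀ b ∈ R, 2 * a - b ∉ R) : PairsSpread (twoLayerTriples R T) := by
  have two : (2 : ZMod p) ≠ 0 := two_ne_zero_of_two_lt hp
  have h2 : ∀ a b : ZMod p, 2 * a = 2 * b → a = b := fun a b h => mul_left_cancel₀ two h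
  intro W hW
  have hF : pairTriples Sum.inl (fun x => Sum.inr (Sum.inl x)) R ⊆ twoLayerTriples R T :=
    Finset.subset_union_left
  have hij : ∀ a x : ZMod p, (Sum.inl a : TwoLayerVertex p T) ≠ Sum.inr (Sum.inl x) := by simp
  have sum_mem : ∀ {a b : ZMod p}, a ≠ b → ¬ (a ∈ R ∧ b ∈ R) →
      (Sum.inl a : TwoLayerVertex p T) ∈ W → (Sum.inl b : TwoLayerVertex p T) ∈ W →
      (Sum.inr (Sum.inl (a + b)) : TwoLayerVertex p T) ∈ W := fun hab hR ha hb =>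
    hW.add_mem Sum.inl_injective hF hab hR ha hb
  have point_mem : ∀ {a x : ZMod p}, a ≠ x - a → ¬ (a ∈ R ∧ x - a ∈ R) →
      (Sum.inl a : TwoLayerVertex p T) ∈ W → (Sum.inr (Sum.inl x) : TwoLayerVertex p T) ∈ W →
      (Sum.inl (x - a) : TwoLayerVertex p T) ∈ W := by
    intro a x hab hR ha hx
    exact hW.of_add_mem hij hF hab hR ha (by simpa using hx)
  have finish : ∀ a c u : ZMod p, a ∉ R → c ∉ R → a ≠ c → u ≠ a → u ≠ c →
      (Sum.inl a : TwoLayerVertex p T) ∈ W → (Sum.inl c : TwoLayerVertex p T) ∈ W →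
      (Sum.inl u : TwoLayerVertex p T) ∈ W → W = Set.univ := by
    intro a c u haR hcR hac hua huc ha hc hu
    obtain ⟨hw, hx⟩ := hW.forall_mem_of_pairTriples hp Sum.inl_injective hij hF haR hcR hac hua
      huc ha hc hu
    rw [Set.eq_univ_iff_forall]
    rintro (v | x | e)
    · exact hw v
    · exact hx x
    · exact hW _ (mem_twoLayerTriples.2 (Or.inr ⟨e, rfl⟩)) (Sum.inl e.1) (by simp)
        (Sum.inr (Sum.inl (2 * e.1))) (by simp) (by simp) (hw _) (hx _) _ (by simp)
  have two_pairs : ∀ a b a' b' : ZMod p, a ∉ R → a' ∉ R → a ≠ b → a' ≠ b' →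
      ¬ (a = a' ∧ b = b') → ¬ (a = b' ∧ b = a') →
      (Sum.inl a : TwoLayerVertex p T) ∈ W → (Sum.inl b : TwoLayerVertex p T) ∈ W →
      (Sum.inl a' : TwoLayerVertex p T) ∈ W → (Sum.inl b' : TwoLayerVertex p T) ∈ W →
      W = Set.univ := by
    intro a b a' b' haR haR' hab hab' hne hne' ha hb ha' hb'
    by_cases haa : a = a'
    · subst haa
      have hbb : b ≠ b' := fun h => hne ⟨rfl, h⟩
      by_cases hbR : b ∈ R
      swap
      · exact finish a b b' haR hbR hab hab'.symm hbb.symm ha hb hb'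
      by_cases hbR' : b' ∈ R
      swap
      · exact finish a b' b haR hbR' hab' hab.symm hbb ha hb' hb
      -- Only a is known to avoid R. The sum a + b' completed with b supplies a second such point, a
      -- + b' - b; if that lies in R, then `hR` lets b and b' be exchanged.
      have go : ∀ b b' : ZMod p, a ≠ b → a ≠ b' → b ∈ R → b ≠ b' → a + b' - b ∉ R →
          (Sum.inl b : TwoLayerVertex p T) ∈ W → (Sum.inl b' : TwoLayerVertex p T) ∈ W →
          W = Set.univ := by
        intro b b' hab hab' hbR hbb hmR hb hb'
        have hbe : b ≠ a + b' - b := fun h => hmR (h ▸ hbR)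
        refine finish a (a + b' - b) b haR hmR ?_ hab.symm hbe ha
          (point_mem hbe (fun h => hmR h.2) hb
            (sum_mem hab' (fun h => haR h.1) ha hb')) hb
        intro h
        apply hbb
        linear_combination h
      by_cases hm : a + b' - b ∈ R
      · exact go b' b hab' hab hbR' hbb.symm (hR a haR b hbR b' hbR' hbb hm) hb' hb
      · exact go b b' hab hab' hbR hbb hm hb hb'
    · by_cases hba : b = a'
      · refine finish a a' b' haR haR' haa (fun h => hne' ⟨h.symm, hba⟩) hab'.symm ha ha' hb'
      · exact finish a a' b haR haR' haa hab.symm hba ha ha' hb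
  have pair_extra : ∀ a b e : ZMod p, a ∉ R → a ≠ b → e ∈ T →
      (Sum.inl a : TwoLayerVertex p T) ∈ W → (Sum.inl b : TwoLayerVertex p T) ∈ W →
      (Sum.inl e : TwoLayerVertex p T) ∈ W →
      (Sum.inr (Sum.inl (2 * e)) : TwoLayerVertex p T) ∈ W → W = Set.univ := by
    intro a b e haR hab heT ha hb he hx
    have heR : e ∉ R := Finset.disjoint_left.1 hTR heT
    -- The sum 2e reflects b to 2e - b, a third point; by `hT`, b and its reflection are not both in
    -- R.
    have go : ∀ b : ZMod p, e ≠ b → (Sum.inl b : TwoLayerVertex p T) ∈ W → W = Set.univ := by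
      intro b heb hb
      have hbe : b ≠ 2 * e - b := fun h => heb (h2 _ _ (by linear_combination -h))
      have hne : e ≠ 2 * e - b := fun h => heb (by linear_combination -h)
      by_cases hbR : b ∈ R
      · have hmR := hT e heT b hbR
        exact finish e (2 * e - b) b heR hmR hne heb.symm hbe he
          (point_mem hbe (fun h => hmR h.2) hb hx) hb
      · exact finish e b (2 * e - b) heR hbR heb hne.symm hbe.symm he hb
          (point_mem hbe (fun h => hbR h.1) hb hx)
    by_cases hea : e = a
    · exact go b (hea ▸ hab) hb
    · exact go a hea ha
  have norm : ∀ a b : ZMod p, a ≠ b → ¬ (a ∈ R ∧ b ∈ R) →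
      (Sum.inl a : TwoLayerVertex p T) ∈ W → (Sum.inl b : TwoLayerVertex p T) ∈ W →
      ∃ c d : ZMod p, c ∉ R ∧ c ≠ d ∧ ((c = a ∧ d = b) ∨ (c = b ∧ d = a)) ∧
        (Sum.inl c : TwoLayerVertex p T) ∈ W ∧ (Sum.inl d : TwoLayerVertex p T) ∈ W := by
    intro a b hab hR ha hb
    by_cases haR : a ∈ R
    · exact ⟨b, a, fun h => hR ⟨haR, h⟩, hab.symm, Or.inr ⟨rfl, rfl⟩, hb, ha⟩
    · exact ⟨a, b, haR, hab, Or.inl ⟨rfl, rfl⟩, ha, hb⟩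
  intro X hX Y hY hne hXW hYW
  rcases mem_twoLayerTriples.1 hX with ⟨a, b, hab, hab2, rfl⟩ | ⟨e, rfl⟩ <;>
  rcases mem_twoLayerTriples.1 hY with ⟨a', b', hab', hab2', rfl⟩ | ⟨e', rfl⟩ <;>
  simp only [Finset.mem_insert, Finset.mem_singleton, forall_eq_or_imp, forall_eq] at hXW hYW
  · have hn1 : ¬ (a = a' ∧ b = b') := by rintro ⟨rfl, rfl⟩; exact hne rfl
    have hn2 : ¬ (a = b' ∧ b = a') := by
      rintro ⟨rfl, rfl⟩
      apply hne
      rw [Finset.insert_comm, add_comm]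
    obtain ⟨c, d, hcR, hcd, hc, hcW, hdW⟩ := norm a b hab hab2 hXW.1 hXW.2.1
    obtain ⟨c', d', hcR', hcd', hc', hcW', hdW'⟩ := norm a' b' hab' hab2' hYW.1 hYW.2.1
    exact two_pairs c d c' d' hcR hcR' hcd hcd' (by grind) (by grind) hcW hdW hcW' hdW'
  · obtain ⟨c, d, hcR, hcd, -, hcW, hdW⟩ := norm a b hab hab2 hXW.1 hXW.2.1
    exact pair_extra c d e' hcR hcd e'.2 hcW hdW hYW.1 hYW.2.1
  · obtain ⟨c, d, hcR, hcd, -, hcW, hdW⟩ := norm a' b' hab' hab2' hYW.1 hYW.2.1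
    exact pair_extra c d e hcR hcd e.2 hcW hdW hXW.1 hXW.2.1
  · have hee : (e : ZMod p) ≠ e' := fun h => hne (by rw [Subtype.ext h])
    exact pair_extra e e' e (Finset.disjoint_left.1 hTR e.2) hee e.2 hXW.1 hYW.1 hXW.1 hXW.2.1

end TwoLayers

/-! ### The three-layer system, for 3p < n ≤ 4p -/

section ThreeLayers

variable {p : ℕ} [Fact p.Prime]

/-- Three layers indexed by `ZMod p`, together with an extra vertex for each element of `T`. -/
abbrev ThreeLayerVertex (p : ℕ) (T : Finset (ZMod p)) : Type :=
  ZMod p ⊕ (ZMod p ⊕ (ZMod p ⊕ {a // a ∈ T}))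

variable {T : Finset (ZMod p)}

/-- The vertex `a` of the first layer. -/
abbrev layerOne (T : Finset (ZMod p)) (a : ZMod p) : ThreeLayerVertex p T := Sum.inl a

/-- The vertex `a` of the second layer. -/
abbrev layerTwo (T : Finset (ZMod p)) (a : ZMod p) : ThreeLayerVertex p T := Sum.inr (Sum.inl a)

/-- The vertex `a` of the third layer. -/
abbrev layerThree (T : Finset (ZMod p)) (a : ZMod p) : ThreeLayerVertex p T :=
  Sum.inr (Sum.inr (Sum.inl a))

/-- The extra vertex of `a`. -/
abbrev extraVertex (e : {a // a ∈ T}) : ThreeLayerVertex p T := Sum.inr (Sum.inr (Sum.inr e))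

/-- The sum triples from the first layer to the second and from the second to the third, the
triples `{a, 2a, 4a}`, and a triple `{a, 4a + 1, extra a}` for each `a ∈ T`. -/
def threeLayerTriples (T : Finset (ZMod p)) : Finset (Finset (ThreeLayerVertex p T)) :=
  (pairTriples (layerOne T) (layerTwo T) ∅ ∪ pairTriples (layerTwo T) (layerThree T) ∅) ∪
    ((Finset.univ.image fun a : ZMod p => {layerOne T a, layerTwo T (2 * a), layerThree T (4 * a)}) ∪
      Finset.univ.image fun e : {a // a ∈ T} =>
        {layerOne T e.1, layerThree T (4 * e.1 + 1), extraVertex e})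

theorem mem_threeLayerTriples {X : Finset (ThreeLayerVertex p T)} : X ∈ threeLayerTriples T ↔
    ((∃ a b, a ≠ b ∧ X = {layerOne T a, layerOne T b, layerTwo T (a + b)}) ∨
      (∃ a b, a ≠ b ∧ X = {layerTwo T a, layerTwo T b, layerThree T (a + b)})) ∨
    (∃ a, X = {layerOne T a, layerTwo T (2 * a), layerThree T (4 * a)}) ∨
    ∃ e : {a // a ∈ T}, X = {layerOne T e.1, layerThree T (4 * e.1 + 1), extraVertex e} := by
  simp only [threeLayerTriples, Finset.mem_union, mem_pairTriples, Finset.mem_image,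
    Finset.mem_univ, true_and, eq_comm (a := X), Finset.notMem_empty, and_self, not_false_eq_true]

theorem isTripleSystem_threeLayerTriples : IsTripleSystem (threeLayerTriples T) := by
  intro X hX
  rcases mem_threeLayerTriples.1 hX with (⟨a, b, hab, rfl⟩ | ⟨a, b, hab, rfl⟩) | ⟨a, rfl⟩ | ⟨e, rfl⟩
  · exact Finset.card_eq_three.2 ⟨_, _, _, by simpa using hab, by simp, by simp, rfl⟩
  · exact Finset.card_eq_three.2 ⟨_, _, _, by simpa using hab, by simp, by simp, rfl⟩
  · exact Finset.card_eq_three.2 ⟨_, _, _, by simp, by simp, by simp, rfl⟩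
  · exact Finset.card_eq_three.2 ⟨_, _, _, by simp, by simp, by simp, rfl⟩

/-- The triples {a, 2a, 4a} use the doubling pairs missed by both sum systems. The shift in 4a + 1
keeps the extra triples off their pairs between the first and third layers. -/
theorem isLinear_threeLayerTriples (hp : 2 < p) : IsLinear (threeLayerTriples T) := by
  have h2 : ∀ a b : ZMod p, 2 * a = 2 * b → a = b := fun a b h =>
    mul_left_cancel₀ (two_ne_zero_of_two_lt hp) h
  have h4 : ∀ a b : ZMod p, 4 * a = 4 * b → a = b := fun a b h =>
    h2 _ _ (h2 _ _ (by linear_combination h))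
  have h2' : ∀ a b : ZMod p, 2 * a + b = 4 * a → b = 2 * a := fun a b h => by
    linear_combination h
  have h1 : (1 : ZMod p) ≠ 0 := one_ne_zero
  apply isLinear_of_unique
  intro X hX Y hY x y hxy hx hy hx' hy'
  rcases mem_threeLayerTriples.1 hX with
    (⟨a, b, hab, rfl⟩ | ⟨a, b, hab, rfl⟩) | ⟨a, rfl⟩ | ⟨e, rfl⟩ <;>
  rcases mem_threeLayerTriples.1 hY with
    (⟨a', b', hab', rfl⟩ | ⟨a', b', hab', rfl⟩) | ⟨a', rfl⟩ | ⟨e', rfl⟩ <;>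
  simp only [Finset.mem_insert, Finset.mem_singleton] at hx hy hx' hy'
  case inl.inl.inl.inl =>
    suffices h : (a = a' ∧ b = b') ∨ (a = b' ∧ b = a') by
      rcases h with ⟨rfl, rfl⟩ | ⟨rfl, rfl⟩
      · rfl
      · rw [Finset.insert_comm, add_comm]
    rcases x with x | x | x | x <;> rcases y with y | y | y | y <;>
      simp at hx hy hx' hy' hxy <;> grind
  case inl.inr.inl.inr =>
    suffices h : (a = a' ∧ b = b') ∨ (a = b' ∧ b = a') by
      rcases h with ⟨rfl, rfl⟩ | ⟨rfl, rfl⟩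
      · rfl
      · rw [Finset.insert_comm, add_comm]
    rcases x with x | x | x | x <;> rcases y with y | y | y | y <;>
      simp at hx hy hx' hy' hxy <;> grind
  case inr.inl.inr.inl =>
    suffices h : a = a' by rw [h]
    rcases x with x | x | x | x <;> rcases y with y | y | y | y <;>
      simp at hx hy hx' hy' hxy <;> grind
  case inr.inr.inr.inr =>
    suffices h : e = e' by rw [h]
    rcases x with x | x | x | x <;> rcases y with y | y | y | y <;>
      simp at hx hy hx' hy' hxy <;> grind
  all_goals
    exfalso
    rcases x with x | x | x | x <;> rcases y with y | y | y | y <;>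
      simp at hx hy hx' hy' hxy <;> grind

theorem card_threeLayerTriples_le :
    (threeLayerTriples T).card ≤ 2 * p.choose 2 + p + T.card := by
  have h1 := card_pairTriples_le (layerOne T) (layerTwo T) ∅
  have h2 := card_pairTriples_le (layerTwo T) (layerThree T) ∅
  have h3 := Finset.card_image_le (s := Finset.univ) (f := fun a : ZMod p =>
    ({layerOne T a, layerTwo T (2 * a), layerThree T (4 * a)} : Finset (ThreeLayerVertex p T)))
  have h4 := Finset.card_image_le (s := Finset.univ) (f := fun e : {a // a ∈ T} =>
    ({layerOne T e.1, layerThree T (4 * e.1 + 1), extraVertex e} : Finset (ThreeLayerVertex p T)))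
  rw [Finset.card_univ, ZMod.card] at h3
  rw [Finset.card_univ, Fintype.card_coe] at h4
  refine (Finset.card_union_le _ _).trans ?_
  have h5 := Finset.card_union_le (pairTriples (layerOne T) (layerTwo T) ∅)
    (pairTriples (layerTwo T) (layerThree T) ∅)
  have h6 := Finset.card_union_le
    (Finset.univ.image fun a : ZMod p =>
      ({layerOne T a, layerTwo T (2 * a), layerThree T (4 * a)} : Finset (ThreeLayerVertex p T)))
    (Finset.univ.image fun e : {a // a ∈ T} =>
      {layerOne T e.1, layerThree T (4 * e.1 + 1), extraVertex e})
  omega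

/-- Three second-layer vertices generate the second and third layers, and then the triples {a, 2a,
4a} return the first. Every pair of triples is reduced to this situation, mostly through three
first-layer points, whose pairwise sums are distinct. -/
theorem pairsSpread_threeLayerTriples (hp : 2 < p) : PairsSpread (threeLayerTriples T) := by
  have two : (2 : ZMod p) ≠ 0 := two_ne_zero_of_two_lt hp
  have h2 : ∀ a b : ZMod p, 2 * a = 2 * b → a = b := fun a b h => mul_left_cancel₀ two h
  intro W hW
  have hF₁ : pairTriples (layerOne T) (layerTwo T) ∅ ⊆ threeLayerTriples T :=
    Finset.subset_union_left.trans Finset.subset_union_left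
  have hF₂ : pairTriples (layerTwo T) (layerThree T) ∅ ⊆ threeLayerTriples T :=
    Finset.subset_union_right.trans Finset.subset_union_left
  have hi₁ : (layerOne T).Injective := fun _ _ h => by simpa using h
  have hi₂ : (layerTwo T).Injective := fun _ _ h => by simpa using h
  have hij₁ : ∀ a x, layerOne T a ≠ layerTwo T x := by simp
  have hij₂ : ∀ a x, layerTwo T a ≠ layerThree T x := by simp
  have sum_mem : ∀ {a b}, a ≠ b → layerOne T a ∈ W → layerOne T b ∈ W → layerTwo T (a + b) ∈ W :=
    fun hab ha hb => hW.add_mem hi₁ hF₁ hab (by simp) ha hb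
  have point_mem : ∀ {a x}, a ≠ x - a → layerOne T a ∈ W → layerTwo T x ∈ W →
      layerOne T (x - a) ∈ W := fun hab ha hx =>
    hW.of_add_mem hij₁ hF₁ hab (by simp) ha (by simpa using hx)
  have diag_mem : ∀ {a}, layerTwo T (2 * a) ∈ W → layerThree T (4 * a) ∈ W → layerOne T a ∈ W :=
    fun {a} hx hz => hW _ (mem_threeLayerTriples.2 (Or.inr (Or.inl ⟨a, rfl⟩))) _ (by simp) _
      (by simp) (hij₂ _ _) hx hz _ (by simp)
  have of_second : (∀ x, layerTwo T x ∈ W) → (∀ z, layerThree T z ∈ W) → W = Set.univ := by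
    intro hx hz
    have hw : ∀ a, layerOne T a ∈ W := fun a => diag_mem (hx _) (hz _)
    rw [Set.eq_univ_iff_forall]
    rintro (a | x | z | e)
    · exact hw a
    · exact hx x
    · exact hz z
    · exact hW _ (mem_threeLayerTriples.2 (Or.inr (Or.inr ⟨e, rfl⟩))) (layerOne T e.1) (by simp)
        (layerThree T (4 * e.1 + 1)) (by simp) (by simp) (hw _) (hz _) _ (by simp)
  have three_second : ∀ x y z, x ≠ y → z ≠ x → z ≠ y → layerTwo T x ∈ W → layerTwo T y ∈ W →
      layerTwo T z ∈ W → W = Set.univ := by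
    intro x y z hxy hzx hzy hx hy hz
    obtain ⟨h, h'⟩ := hW.forall_mem_of_pairTriples hp hi₂ hij₂ hF₂ (by simp) (by simp) hxy hzx hzy
      hx hy hz
    exact of_second h h'
  have three_first : ∀ a b c, a ≠ b → c ≠ a → c ≠ b → layerOne T a ∈ W → layerOne T b ∈ W →
      layerOne T c ∈ W → W = Set.univ := by
    intro a b c hab hca hcb ha hb hc
    refine three_second (a + b) (a + c) (b + c) ?_ ?_ ?_ (sum_mem hab ha hb)
      (sum_mem hca.symm ha hc) (sum_mem hcb.symm hb hc)
    · exact fun h => hcb (by linear_combination -h)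
    · exact fun h => hca (by linear_combination h)
    · exact fun h => hab (by linear_combination -h)
  have point_two_sums : ∀ a x y, x ≠ y → layerOne T a ∈ W → layerTwo T x ∈ W →
      layerTwo T y ∈ W → W = Set.univ := by
    intro a x y hxy ha hx hy
    -- If x = 2a, reflecting a in x gives nothing new; a is reflected in y first, and the result in
    -- x.
    have go : ∀ x y, x ≠ y → x = 2 * a → layerTwo T x ∈ W → layerTwo T y ∈ W → W = Set.univ := by
      intro x y hxy hxa hx hy
      have h1 : a ≠ y - a := fun h => hxy (by linear_combination hxa + h)
      have h3 : y - a ≠ x - (y - a) := fun h => hxy (h2 _ _ (by linear_combination hxa - h))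
      refine three_first a (y - a) (x - (y - a)) h1 ?_ h3.symm ha (point_mem h1 ha hy)
        (point_mem h3 (point_mem h1 ha hy) hx)
      exact fun h => hxy (by linear_combination h)
    by_cases hxa : x = 2 * a
    · exact go x y hxy hxa hx hy
    by_cases hya : y = 2 * a
    · exact go y x hxy.symm hya hy hx
    have h1 : a ≠ x - a := fun h => hxa (by linear_combination -h)
    have h3 : a ≠ y - a := fun h => hya (by linear_combination -h)
    exact three_first a (x - a) (y - a) h1 h3.symm (fun h => hxy (by linear_combination -h)) ha
      (point_mem h1 ha hx) (point_mem h3 ha hy)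
  have pair_third : ∀ a b z, a ≠ b → layerOne T a ∈ W → layerOne T b ∈ W → layerThree T z ∈ W →
      W = Set.univ := by
    intro a b z hab ha hb hz
    have hx := sum_mem hab ha hb
    -- If z is twice the sum a + b, no sum triple completes them, but then z = 4c for the midpoint c
    -- of a and b, and {c, 2c, 4c} yields c.
    by_cases h : a + b = z - (a + b)
    · set c := (a + b) / 2 with hc
      have hc2 : 2 * c = a + b := by rw [hc]; field_simp
      have hcW : layerOne T c ∈ W := by
        apply diag_mem
        · rwa [hc2]
        · rwa [show 4 * c = z by linear_combination 2 * hc2 + h]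
      exact three_first a b c hab (fun h' => hab (by linear_combination hc2 - 2 * h'))
        (fun h' => hab (by linear_combination 2 * h' - hc2)) ha hb hcW
    · refine point_two_sums a _ _ h ha hx (hW.of_add_mem hij₂ hF₂ h (by simp) hx ?_)
      rwa [add_sub_cancel]
  have second_pair : ∀ {X : Finset (ThreeLayerVertex p T)},
      (∃ a b, a ≠ b ∧ X = {layerTwo T a, layerTwo T b, layerThree T (a + b)}) →
      (∀ v ∈ X, v ∈ W) → (∃ c, layerOne T c ∈ W) → W = Set.univ := by
    rintro X ⟨a, b, hab, rfl⟩ hX ⟨c, hc⟩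
    exact point_two_sums c a b hab hc (hX _ (by simp)) (hX _ (by simp))
  have first_other : ∀ {X : Finset (ThreeLayerVertex p T)},
      (∃ a b, a ≠ b ∧ X = {layerOne T a, layerOne T b, layerTwo T (a + b)}) →
      (∀ v ∈ X, v ∈ W) → (∃ z, layerThree T z ∈ W) → W = Set.univ := by
    rintro X ⟨a, b, hab, rfl⟩ hX ⟨z, hz⟩
    exact pair_third a b z hab (hX _ (by simp)) (hX _ (by simp)) hz
  have diag_extra : ∀ a b, layerOne T a ∈ W → layerTwo T (2 * a) ∈ W → layerThree T (4 * a) ∈ W →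
      layerOne T b ∈ W → layerThree T (4 * b + 1) ∈ W → W = Set.univ := by
    intro a b ha hx hz hb hz'
    by_cases hab : a = b
    · subst hab
      have hne : 2 * a ≠ 2 * a + 1 := fun h => one_ne_zero (α := ZMod p) (by linear_combination -h)
      refine point_two_sums a _ _ hne ha hx (hW.of_add_mem hij₂ hF₂ hne (by simp) hx ?_)
      rwa [show 2 * a + (2 * a + 1) = 4 * a + 1 by ring]
    · exact pair_third a b _ hab ha hb hz
  intro X hX Y hY hne hXW hYW
  rcases mem_threeLayerTriples.1 hX with (hX1 | hX2) | ⟨a, rfl⟩ | ⟨e, rfl⟩ <;>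
  rcases mem_threeLayerTriples.1 hY with (hY1 | hY2) | ⟨a', rfl⟩ | ⟨e', rfl⟩
  · obtain ⟨a, b, hab, rfl⟩ := hX1
    obtain ⟨a', b', hab', rfl⟩ := hY1
    simp only [Finset.mem_insert, Finset.mem_singleton, forall_eq_or_imp, forall_eq] at hXW hYW
    by_cases h : a' = a ∨ a' = b
    · refine three_first a b b' hab ?_ ?_ hXW.1 hXW.2.1 hYW.2.1
      · rintro rfl
        rcases h with rfl | rfl
        · exact hab' rfl
        · exact hne (by rw [Finset.insert_comm, add_comm])
      · rintro rfl
        rcases h with rfl | rfl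
        · exact hne rfl
        · exact hab' rfl
    · rw [not_or] at h
      exact three_first a b a' hab h.1 h.2 hXW.1 hXW.2.1 hYW.1
  · obtain ⟨c, _, _, rfl⟩ := hX1
    exact second_pair hY2 hYW ⟨c, hXW _ (by simp)⟩
  · exact first_other hX1 hXW ⟨_, hYW (layerThree T (4 * a')) (by simp)⟩
  · exact first_other hX1 hXW ⟨_, hYW (layerThree T (4 * e'.1 + 1)) (by simp)⟩
  · obtain ⟨c, _, _, rfl⟩ := hY1
    exact second_pair hX2 hXW ⟨c, hYW _ (by simp)⟩
  · obtain ⟨a, b, hab, rfl⟩ := hX2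
    obtain ⟨a', b', hab', rfl⟩ := hY2
    simp only [Finset.mem_insert, Finset.mem_singleton, forall_eq_or_imp, forall_eq] at hXW hYW
    by_cases h : a' = a ∨ a' = b
    · refine three_second a b b' hab ?_ ?_ hXW.1 hXW.2.1 hYW.2.1
      · rintro rfl
        rcases h with rfl | rfl
        · exact hab' rfl
        · exact hne (by rw [Finset.insert_comm, add_comm])
      · rintro rfl
        rcases h with rfl | rfl
        · exact hne rfl
        · exact hab' rfl
    · rw [not_or] at h
      exact three_second a b a' hab h.1 h.2 hXW.1 hXW.2.1 hYW.1
  · exact second_pair hX2 hXW ⟨_, hYW (layerOne T a') (by simp)⟩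
  · exact second_pair hX2 hXW ⟨_, hYW (layerOne T e'.1) (by simp)⟩
  · exact first_other hY1 hYW ⟨_, hXW (layerThree T (4 * a)) (by simp)⟩
  · exact second_pair hY2 hYW ⟨_, hXW (layerOne T a) (by simp)⟩
  · have haa : a ≠ a' := by rintro rfl; exact hne rfl
    simp only [Finset.mem_insert, Finset.mem_singleton, forall_eq_or_imp, forall_eq] at hXW hYW
    exact pair_third a a' _ haa hXW.1 hYW.1 hXW.2.2
  · simp only [Finset.mem_insert, Finset.mem_singleton, forall_eq_or_imp, forall_eq] at hXW hYW
    exact diag_extra a e' hXW.1 hXW.2.1 hXW.2.2 hYW.1 hYW.2.1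
  · exact first_other hY1 hYW ⟨_, hXW (layerThree T (4 * e.1 + 1)) (by simp)⟩
  · exact second_pair hY2 hYW ⟨_, hXW (layerOne T e.1) (by simp)⟩
  · simp only [Finset.mem_insert, Finset.mem_singleton, forall_eq_or_imp, forall_eq] at hXW hYW
    exact diag_extra a' e hYW.1 hYW.2.1 hYW.2.2 hXW.1 hXW.2.1
  · have hee : (e : ZMod p) ≠ e' := fun h => hne (by rw [Subtype.ext h])
    simp only [Finset.mem_insert, Finset.mem_singleton, forall_eq_or_imp, forall_eq] at hXW hYW
    exact pair_third e e' _ hee hXW.1 hYW.1 hXW.2.1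

end ThreeLayers

/-! ### Choice of parameters and the bound n²/9 -/

section Existence

variable {p : ℕ} [Fact p.Prime]

/-- The residues of the natural numbers in `[l, l + k)`. -/
def residueInterval (p l k : ℕ) : Finset (ZMod p) := (Finset.Ico l (l + k)).image Nat.cast

theorem mem_residueInterval {l k : ℕ} {a : ZMod p} :
    a ∈ residueInterval p l k ↔ ∃ i : ℕ, l ≤ i ∧ i < l + k ∧ a = i := by
  simp only [residueInterval, Finset.mem_image, Finset.mem_Ico, and_assoc, eq_comm (a := a)]

theorem card_residueInterval {l k : ℕ} (h : l + k ≤ p) : (residueInterval p l k).card = k := by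
  rw [residueInterval, Finset.card_image_of_injOn]
  · simp
  · intro i hi j hj hij
    simp only [Finset.coe_Ico, Set.mem_Ico] at hi hj
    have := (ZMod.natCast_eq_natCast_iff' i j p).1 hij
    rwa [Nat.mod_eq_of_lt (by omega), Nat.mod_eq_of_lt (by omega)] at this

theorem natCast_eq_cases {x y : ℕ} (h : (x : ZMod p) = y) (hxy : x < y + 2 * p) (hyx : y < x + p) :
    x = y ∨ x = y + p := by
  obtain ⟨k, hk⟩ := (ZMod.intCast_eq_intCast_iff_dvd_sub (y : ℤ) (x : ℤ) p).1 (by simpa using h.symm)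
  have hp : (0 : ℤ) < p := by exact_mod_cast (Fact.out : p.Prime).pos
  have h1 : k < 2 := by
    by_contra hc
    have : (p : ℤ) * 2 ≤ p * k := mul_le_mul_of_nonneg_left (by omega) hp.le
    omega
  have h2 : -1 < k := by
    by_contra hc
    have : (p : ℤ) * k ≤ p * (-1) := mul_le_mul_of_nonneg_left (by omega) hp.le
    omega
  obtain rfl | rfl : k = 0 ∨ k = 1 := by omega
  · left; omega
  · right; omega

/-- With R = [0, r), a bad configuration for `hR` wraps around on just one side, forcing p < 3r. For
i in [r, r + t), 2i exceeds any sum of two elements of R and stays below p, so `hT` holds; for r = 0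
it is vacuous. -/
theorem pairsSpread_twoLayerTriples_residueInterval (hp : 2 < p) {r t : ℕ} (hr : 3 * r ≤ p)
    (hrt : r + t ≤ p) (ht : r = 0 ∨ 2 * (r + t) ≤ p + 1) :
    PairsSpread (twoLayerTriples (residueInterval p 0 r) (residueInterval p r t)) := by
  apply pairsSpread_twoLayerTriples hp
  · rw [Finset.disjoint_left]
    intro a ha ha'
    obtain ⟨i, hi, hi', rfl⟩ := mem_residueInterval.1 ha
    obtain ⟨j, -, hj', hij⟩ := mem_residueInterval.1 ha'
    rcases natCast_eq_cases hij (by omega) (by omega) with h | h <;> omega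
  · intro a ha b hb b' hb' hbb h1 h2
    obtain ⟨β, -, hβ, rfl⟩ := mem_residueInterval.1 hb
    obtain ⟨β', -, hβ', rfl⟩ := mem_residueInterval.1 hb'
    obtain ⟨f, -, hf, hf'⟩ := mem_residueInterval.1 h1
    obtain ⟨g, -, hg, hg'⟩ := mem_residueInterval.1 h2
    have hα := ZMod.val_lt a
    have haα : a = (a.val : ZMod p) := (ZMod.natCast_zmod_val a).symm
    have hαr : r ≤ a.val := by
      by_contra hc
      exact ha (mem_residueInterval.2 ⟨a.val, by omega, by omega, haα⟩)
    generalize a.val = α at hα haα hαr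
    subst haα
    have e1 : ((α + β' : ℕ) : ZMod p) = ((β + f : ℕ) : ZMod p) := by
      push_cast; linear_combination hf'
    have e2 : ((α + β : ℕ) : ZMod p) = ((β' + g : ℕ) : ZMod p) := by
      push_cast; linear_combination hg'
    have hne : β ≠ β' := by rintro rfl; exact hbb rfl
    rcases natCast_eq_cases e1 (by omega) (by omega) with h | h <;>
    rcases natCast_eq_cases e2 (by omega) (by omega) with h' | h' <;> omega
  · intro a ha b hb hab
    obtain ⟨i, hi, hi', rfl⟩ := mem_residueInterval.1 ha
    obtain ⟨j, -, hj', rfl⟩ := mem_residueInterval.1 hb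
    obtain ⟨k, -, hk', hk⟩ := mem_residueInterval.1 hab
    have e : ((2 * i : ℕ) : ZMod p) = ((j + k : ℕ) : ZMod p) := by
      push_cast; linear_combination hk
    rcases natCast_eq_cases e (by omega) (by omega) with h | h <;> omega

theorem two_mul_choose_two (k : ℕ) : (2 * k.choose 2 : ℤ) = k * (k - 1) := by
  have h := Nat.cast_choose_two ℚ k
  have : (2 * k.choose 2 : ℚ) = k * (k - 1) := by rw [h]; ring
  exact_mod_cast this

theorem xiWsp_le_of_prime (hp : 2 < p) {n : ℕ} (h2 : 2 * p ≤ n) (h4 : n ≤ 4 * p) :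
    ∃ k : ℕ, xiWsp n ≤ k ∧ 9 * k ≤ n ^ 2 := by
  have hone : ∀ {V : Type} [DecidableEq V] {F : Finset (Finset V)} {i j : ZMod p → V},
      i.Injective → (∀ a x, i a ≠ j x) → ∀ {R : Finset (ZMod p)}, pairTriples i j R ⊆ F →
      ∀ a : ZMod p, a ∉ R → 1 < F.card := by
    intro V _ F i j hi hij R hF a ha
    have two : (2 : ZMod p) ≠ 0 := two_ne_zero_of_two_lt hp
    have hne : ∀ u : ZMod p, u ≠ 0 → a ≠ a + u := fun u hu h => hu (by linear_combination -h)
    have h1 : (1 : ZMod p) ≠ 0 := one_ne_zero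
    refine Finset.one_lt_card.2 ⟨_, hF (mem_pairTriples.2 ⟨a, a + 1, hne 1 h1, fun h => ha h.1, rfl⟩),
      _, hF (mem_pairTriples.2 ⟨a, a + -1, hne (-1) (neg_ne_zero.2 h1), fun h => ha h.1, rfl⟩), ?_⟩
    intro h
    have := (Finset.ext_iff.1 h (i (a + 1))).1 (by simp)
    simp only [Finset.mem_insert, Finset.mem_singleton, hi.eq_iff, hij, or_false] at this
    rcases this with h | h
    · exact h1 (by linear_combination h)
    · exact two (by linear_combination h)
  by_cases h3 : n ≤ 3 * p
  · obtain ⟨t, rfl⟩ := Nat.exists_eq_add_of_le h2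
    obtain ⟨r, hr, hrt, ht, hrp, hcount⟩ : ∃ r, 3 * r ≤ p ∧ r + t ≤ p ∧
        (r = 0 ∨ 2 * (r + t) ≤ p + 1) ∧ r < p ∧
        (9 * (p * (p - 1)) - 9 * (r * (r - 1)) + 18 * t : ℤ) ≤ 2 * (2 * p + t) ^ 2 := by
      -- For r = 0 the inequality reads p² + 18t ≤ 9p + 8pt + 2t², and 8pt pays for p² once p ≤ 8t.
      -- Otherwise omitting the pairs inside R must pay; r = p / 3 is the largest value with 3r ≤ p,
      -- and t < p / 8 leaves room for T below the midpoint.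
      by_cases h8 : p ≤ 8 * t
      · refine ⟨0, by omega, by omega, Or.inl rfl, by omega, ?_⟩
        have h8' : (p : ℤ) ≤ 8 * t := by exact_mod_cast h8
        have ht : (t : ℤ) ≤ p := by omega
        have hp' : (3 : ℤ) ≤ p := by exact_mod_cast hp
        push_cast
        by_cases h2t : (2 * t : ℤ) ≤ p
        · nlinarith
        · nlinarith
      · refine ⟨p / 3, by omega, by omega, Or.inr (by omega), by omega, ?_⟩
        have hp' : (3 : ℤ) ≤ p := by exact_mod_cast hp
        have ht0 : (0 : ℤ) ≤ t := by positivity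
        have hr : (p : ℤ) ≤ 3 * (p / 3 : ℕ) + 2 := by omega
        generalize p / 3 = r at hr
        have : (p - 2 : ℤ) * (p - 2 - 3) ≤ (3 * r) * (3 * r - 3) := by
          -- The product x(x - 3) is monotone only in the right range, so r = 0, impossible since p
          -- ≥ 3, is split off.
          by_cases h1 : r = 0
          · subst h1; push_cast at hr; omega
          · have h1' : (1 : ℤ) ≤ r := by exact_mod_cast Nat.one_le_iff_ne_zero.2 h1
            nlinarith
        nlinarith
    refine ⟨_, xiWsp_le_of_card_eq ?_ isTripleSystem_twoLayerTriples (isLinear_twoLayerTriples hp)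
      (pairsSpread_twoLayerTriples_residueInterval hp hr hrt ht)
      (hone Sum.inl_injective (by simp) Finset.subset_union_left (r : ZMod p) ?_), ?_⟩
    · simp only [Fintype.card_sum, ZMod.card, Fintype.card_coe, card_residueInterval hrt]
      omega
    · intro h
      obtain ⟨j, -, hj, hrj⟩ := mem_residueInterval.1 h
      rcases natCast_eq_cases hrj (by omega) (by omega) with h | h <;> omega
    · have hc := card_twoLayerTriples_le (R := residueInterval p 0 r) (T := residueInterval p r t)
      rw [card_residueInterval (by omega), card_residueInterval hrt] at hc
      have e1 := two_mul_choose_two p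
      have e2 := two_mul_choose_two r
      generalize (twoLayerTriples (residueInterval p 0 r) (residueInterval p r t)).card = c at hc
      zify at hc ⊢
      nlinarith
  · obtain ⟨t, rfl⟩ := Nat.exists_eq_add_of_le (not_le.1 h3).le
    have ht : 0 + t ≤ p := by omega
    refine ⟨_, xiWsp_le_of_card_eq ?_ (isTripleSystem_threeLayerTriples
      (T := residueInterval p 0 t)) (isLinear_threeLayerTriples hp)
      (pairsSpread_threeLayerTriples hp)
      (hone (i := layerOne _) (j := layerTwo _) (R := ∅) (fun _ _ h => by simpa using h) (by simp)
        (Finset.subset_union_left.trans Finset.subset_union_left) 0 (by simp)), ?_⟩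
    · simp only [Fintype.card_sum, ZMod.card, Fintype.card_coe, card_residueInterval ht]
      omega
    · have hc := card_threeLayerTriples_le (T := residueInterval p 0 t)
      rw [card_residueInterval ht] at hc
      have e1 := two_mul_choose_two p
      generalize (threeLayerTriples (residueInterval p 0 t)).card = c at hc
      zify at hc ⊢
      have hp' : (3 : ℤ) ≤ p := by exact_mod_cast hp
      nlinarith

theorem xiWsp_three_le : xiWsp 3 ≤ 1 := by
  refine sInf_le ⟨{Finset.univ}, ?_, ?_, ?_, ?_, by simp⟩
  · simp [IsTripleSystem]
  · simp [IsLinear]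
  · simp [vertexSet]
  · intro F' hF' hcard
    exact absurd (Finset.card_le_card hF') (by simpa using hcard)

theorem exists_xiWsp_eq {n : ℕ} (hn : n ≡ 3 [MOD 6]) :
    ∃ k : ℕ, xiWsp n = k ∧ 9 * k ≤ n ^ 2 := by
  suffices h : ∃ k : ℕ, xiWsp n ≤ k ∧ 9 * k ≤ n ^ 2 by
    obtain ⟨k, hk, hkn⟩ := h
    lift xiWsp n to ℕ using ne_top_of_le_ne_top (ENat.natCast_ne_top k) hk with l
    exact ⟨l, rfl, le_trans (Nat.mul_le_mul_left 9 (by exact_mod_cast hk)) hkn⟩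
  have hn' : n % 6 = 3 := hn
  by_cases h3 : n = 3
  · subst h3
    exact ⟨1, by exact_mod_cast xiWsp_three_le, by norm_num⟩
  -- Bertrand at ⌊n/4⌋, nonzero since n ≥ 9, gives n < 4p and 2p ≤ n.
  · obtain ⟨p, hp, hlt, hle⟩ := Nat.exists_prime_lt_and_le_two_mul (n / 4) (by omega)
    have : Fact p.Prime := ⟨hp⟩
    exact xiWsp_le_of_prime (p := p) (by omega) (by omega) (by omega)

end Existence

end WeakSpread

theorem mainTheorem8 (n : ℕ) (hn : n ≡ 3 [MOD 6]) :
    (∀ (m : ℕ) (L : Matrix (Fin m) (Fin m) (Fin m)), n = 3 * m →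
      WeakSpread.IsLatinSquare L → WeakSpread.IsSubsquareFree L →
        Fintype.card (WeakSpread.LatinVertex m) = n ∧
        WeakSpread.IsTripleSystem (WeakSpread.latinTriples L) ∧
        WeakSpread.IsLinear (WeakSpread.latinTriples L) ∧
        WeakSpread.vertexSet (WeakSpread.latinTriples L) = Set.univ ∧
        WeakSpread.IsWeaklySpreading (WeakSpread.latinTriples L) ∧
        ((WeakSpread.latinTriples L).card : ℝ) = (n : ℝ) ^ 2 / 9) ∧
    ∃ k : ℕ, WeakSpread.xiWsp n = (k : ℕ∞) ∧ (k : ℝ) ≤ (n : ℝ) ^ 2 / 9 := by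
  constructor
  · rintro m L rfl hL hfree
    refine ⟨?_, WeakSpread.isTripleSystem_latinTriples, hL.isLinear_latinTriples,
      hL.vertexSet_latinTriples, (hL.pairsSpread_latinTriples hfree).isWeaklySpreading
        WeakSpread.isTripleSystem_latinTriples, ?_⟩
    · simp only [Fintype.card_sum, Fintype.card_fin]
      omega
    · rw [WeakSpread.card_latinTriples]
      push_cast
      ring
  · obtain ⟨k, hk, hkn⟩ := WeakSpread.exists_xiWsp_eq hn
    refine ⟨k, hk, ?_⟩
    have : (9 * k : ℝ) ≤ (n : ℝ) ^ 2 := by exact_mod_cast hkn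
    linarith
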